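/- Let $a>0$ and let $H$ and $G$ be probability measures on $\mathbb{R}$ (identified with their cdf's). On a probability space let $(E_k)_{k\ge1}$ be i.i.d. exponential$(1)$ random variables, $\Gamma_i=E_1+\cdots+E_i$, and let $(Y_i)_{i\ge1}$ be i.i.d. with distribution $H$, independent of $(\Gamma_i)_{i\ge1}$. Let $P$ be the Dirichlet process $DP(a,H)$ given by Ferguson's series $$P=\sum_{i=1}^{\infty}\frac{L^{-1}(\Gamma_i)}{\sum_{j=1}^{\infty}L^{-1}(\Gamma_j)}\,\delta_{Y_i},\qquad L(x)=a\int_x^\infty t^{-1}e^{-t}\,dt\ \ (x>0),\qquad L^{-1}(y)=\inf\{x>0: L(x)\le y\},$$ and for $N\ge1$ let $$P_N=\sum_{i=1}^{N}J_i\,\delta_{Y_i},\qquad J_i=\frac{G_{a/N}^{-1}(\Gamma_i/\Gamma_{N+1})}{\sum_{j=1}^{N}G_{a/N}^{-1}(\Gamma_j/\Gamma_{N+1})},$$ where $G_{a/N}$ is the co-cdf of the gamma$(a/N,1)$ distribution, so that $G_{a/N}^{-1}(p)=\inf\{x: G_{a/N}(x)\le p\}$ is its $(1-p)$-quantile. For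 cdf's $F$ and $G$ put $d_{CvM}(F,G)=\int_{-\infty}^{\infty}(F(x)-G(x))^2\,G(dx)$. Then, almost surely, $P$ and all $P_N$ $(N\ge1)$ are probability measures and $$d_{CvM}(P_N,G)\longrightarrow d_{CvM}(P,G)\qquad\text{as } N\to\infty .$$ -/

import Mathlib

open MeasureTheory ProbabilityTheory Filter Topology

noncomputable section

/-- The Cramér–von Mises distance `∫ (F(x) - G(x))² G(dx)` between the cdfs of two laws on `ℝ`. -/
def dCvM (F G : Measure ℝ) : ℝ :=
  ∫ x, (cdf F x - cdf G x) ^ 2 ∂G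

/-- `L(x) = a ∫_x^∞ t⁻¹ e^{-t} dt`, for `x > 0`. -/
def levyTail (a x : ℝ) : ℝ :=
  a * ∫ t in Set.Ioi x, t⁻¹ * Real.exp (-t)

/-- The inverse `L⁻¹(y)` of the decreasing function `L` on `(0, ∞)`. -/
def levyTailInv (a y : ℝ) : ℝ :=
  sInf {x : ℝ | 0 < x ∧ levyTail a x ≤ y}

/-- The co-cdf of the gamma distribution with shape `α` and rate `1`. -/
def gammaCoCDF (α x : ℝ) : ℝ :=
  (gammaMeasure α 1).real (Set.Ioi x)

/-- The inverse of the co-cdf: the `(1 - p)`-quantile of the gamma distribution with shape `α`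
and rate `1`. -/
def gammaCoCDFInv (α p : ℝ) : ℝ :=
  sInf {x : ℝ | gammaCoCDF α x ≤ p}

variable {Ω : Type*}

/-- The arrival times `Γ_n = E_1 + ⋯ + E_n`. Sequences are indexed from `0`, so that `E k` is
the variable `E_{k+1}`. -/
def arrival (E : ℕ → Ω → ℝ) (n : ℕ) (ω : Ω) : ℝ :=
  ∑ k ∈ Finset.range n, E k ω

/-- Ferguson's series for the Dirichlet process with concentration `a`, at the sample point `ω`:
`∑ L⁻¹(Γ_i) δ_{Y_i} / ∑ L⁻¹(Γ_i)`. -/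
def fergusonSeries (a : ℝ) (E Y : ℕ → Ω → ℝ) (ω : Ω) : Measure ℝ :=
  Measure.sum fun i : ℕ =>
    ENNReal.ofReal (levyTailInv a (arrival E (i + 1) ω) /
        ∑' j : ℕ, levyTailInv a (arrival E (j + 1) ω)) •
      Measure.dirac (Y i ω)

/-- The weight attached to the atom `Y i` in the finite approximation with `N` atoms:
`G_{a/N}⁻¹(Γ_i / Γ_{N+1}) / ∑_{j ≤ N} G_{a/N}⁻¹(Γ_j / Γ_{N+1})`. -/
def approxWeight (a : ℝ) (E : ℕ → Ω → ℝ) (N i : ℕ) (ω : Ω) : ℝ :=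
  gammaCoCDFInv (a / N) (arrival E (i + 1) ω / arrival E (N + 1) ω) /
    ∑ j ∈ Finset.range N, gammaCoCDFInv (a / N) (arrival E (j + 1) ω / arrival E (N + 1) ω)

/-- The finite approximation `P_N = ∑_{i ≤ N} J_i δ_{Y_i}`, at the sample point `ω`. -/
def approxProcess (a : ℝ) (E Y : ℕ → Ω → ℝ) (N : ℕ) (ω : Ω) : Measure ℝ :=
  ∑ i ∈ Finset.range N, ENNReal.ofReal (approxWeight a E N i ω) • Measure.dirac (Y i ω)

end

/-! The argument is pathwise, at a sample point where every `E k` is positive and `Γ_n / n → 1`,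
which holds almost surely by the strong law. Since `1 / Γ(a/N) = (a/N) / Γ(a/N + 1)`, the rescaled
gamma tail `N * G_{a/N}(x)` tends to `L(x)`. Strict monotonicity of `L` carries this over to the
inverses, and `N * Γ_i / Γ_{N+1} → Γ_i`, so each unnormalised weight converges
(`tendsto_gammaCoCDFInv`).

To sum the weights, the incomplete gamma function is bounded uniformly in the shape by `2 log(1 +
1/x)`. Inverting this bound and using linear growth of `Γ_i` gives a summable majorant `1 /
(e^{d(i+1)} - 1)` (`exists_eventually_gammaCoCDFInv_ratio_le`). Tannery's theorem, applied to
numerator and denominator, gives pointwise convergence of the cdfs, and bounded convergence under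
`G` finishes. -/

/-! ### Incomplete gamma function: bounds uniform in the shape -/

/-- The upper incomplete gamma function `∫_x^∞ t^(s-1) e^{-t} dt`. -/
noncomputable def upperGamma (s x : ℝ) : ℝ :=
  ∫ t in Set.Ioi x, t ^ (s - 1) * Real.exp (-t)

/-- Combines `t ^ s ≤ 1 + t` with `e^{-t} ≤ 2 / (1 + t)^2`. The majorant is free of `s` and has
primitive `-2 log(1 + 1/t)`, so the resulting tail bound can be inverted in closed form. -/
lemma rpow_sub_one_mul_exp_neg_le {s t : ℝ} (hs : 0 ≤ s) (hs1 : s ≤ 1) (ht : 0 < t) :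
    t ^ (s - 1) * Real.exp (-t) ≤ 2 * (t * (1 + t))⁻¹ := by
  have h1 : t ^ s ≤ 1 + t := by
    rcases le_total t 1 with h | h
    · exact (Real.rpow_le_one ht.le h hs).trans (by linarith)
    · calc t ^ s ≤ t ^ (1 : ℝ) := Real.rpow_le_rpow_of_exponent_le h hs1
        _ ≤ 1 + t := by rw [Real.rpow_one]; linarith
  have h2 : Real.exp (-t) ≤ 2 / (1 + t) ^ 2 := by
    rw [Real.exp_neg, le_div_iff₀ (by positivity), inv_mul_le_iff₀ (Real.exp_pos t)]
    have := Real.quadratic_le_exp_of_nonneg ht.le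
    nlinarith
  rw [Real.rpow_sub_one ht.ne']
  calc t ^ s / t * Real.exp (-t) ≤ (1 + t) / t * (2 / (1 + t) ^ 2) := by gcongr
    _ = 2 * (t * (1 + t))⁻¹ := by field_simp

lemma tendsto_neg_log_one_add_inv :
    Tendsto (fun t : ℝ => -Real.log (1 + t⁻¹)) atTop (𝓝 0) := by
  have h : Tendsto (fun t : ℝ => 1 + t⁻¹) atTop (𝓝 (1 + 0)) :=
    tendsto_inv_atTop_zero.const_add 1
  rw [add_zero] at h
  simpa using (h.log one_ne_zero).neg

lemma hasDerivAt_neg_log_one_add_inv {t : ℝ} (ht : 0 < t) :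
    HasDerivAt (fun t : ℝ => -Real.log (1 + t⁻¹)) (t * (1 + t))⁻¹ t := by
  have h := (((hasDerivAt_inv ht.ne').const_add 1).log (by positivity)).neg
  refine h.congr_deriv ?_
  have h1 : 1 + t⁻¹ ≠ 0 := by positivity
  have h2 : 1 + t ≠ 0 := by positivity
  field_simp
  ring

lemma integrableOn_inv_mul_one_add {x : ℝ} (hx : 0 < x) :
    IntegrableOn (fun t : ℝ => (t * (1 + t))⁻¹) (Set.Ioi x) :=
  integrableOn_Ioi_deriv_of_nonneg'
    (fun t ht => hasDerivAt_neg_log_one_add_inv (hx.trans_le ht))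
    (fun t ht => by have : 0 < t := hx.trans ht; positivity) tendsto_neg_log_one_add_inv

lemma integral_inv_mul_one_add {x : ℝ} (hx : 0 < x) :
    ∫ t in Set.Ioi x, (t * (1 + t))⁻¹ = Real.log (1 + x⁻¹) := by
  rw [integral_Ioi_of_hasDerivAt_of_nonneg'
    (fun t ht => hasDerivAt_neg_log_one_add_inv (hx.trans_le ht))
    (fun t ht => by have : 0 < t := hx.trans ht; positivity) tendsto_neg_log_one_add_inv]
  ring

lemma measurable_rpow_mul_exp_neg (s : ℝ) :
    Measurable fun t : ℝ => t ^ (s - 1) * Real.exp (-t) := by fun_prop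

lemma norm_rpow_sub_one_mul_exp_neg_le {s t : ℝ} (hs : 0 ≤ s) (hs1 : s ≤ 1) (ht : 0 < t) :
    ‖t ^ (s - 1) * Real.exp (-t)‖ ≤ 2 * (t * (1 + t))⁻¹ := by
  rw [Real.norm_of_nonneg (by positivity)]
  exact rpow_sub_one_mul_exp_neg_le hs hs1 ht

lemma integrableOn_upperGamma {s x : ℝ} (hs : 0 ≤ s) (hs1 : s ≤ 1) (hx : 0 < x) :
    IntegrableOn (fun t : ℝ => t ^ (s - 1) * Real.exp (-t)) (Set.Ioi x) := by
  refine ((integrableOn_inv_mul_one_add hx).const_mul 2).mono'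
    (measurable_rpow_mul_exp_neg s).aestronglyMeasurable ?_
  filter_upwards [ae_restrict_mem measurableSet_Ioi] with t ht
  exact norm_rpow_sub_one_mul_exp_neg_le hs hs1 (hx.trans ht)

lemma upperGamma_le {s x : ℝ} (hs : 0 ≤ s) (hs1 : s ≤ 1) (hx : 0 < x) :
    upperGamma s x ≤ 2 * Real.log (1 + x⁻¹) := by
  rw [← integral_inv_mul_one_add hx, ← integral_const_mul]
  exact setIntegral_mono_on (integrableOn_upperGamma hs hs1 hx)
    ((integrableOn_inv_mul_one_add hx).const_mul 2) measurableSet_Ioi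
    fun t ht => rpow_sub_one_mul_exp_neg_le hs hs1 (hx.trans ht)

lemma upperGamma_sub {s x y : ℝ} (hs : 0 ≤ s) (hs1 : s ≤ 1) (hx : 0 < x) (hxy : x ≤ y) :
    upperGamma s x - upperGamma s y = ∫ t in x..y, t ^ (s - 1) * Real.exp (-t) := by
  have h := integrableOn_upperGamma hs hs1 hx
  rw [upperGamma, upperGamma, intervalIntegral.integral_of_le hxy, sub_eq_iff_eq_add,
    ← Set.Ioc_union_Ioi_eq_Ioi hxy, setIntegral_union (Set.Ioc_disjoint_Ioi le_rfl)
      measurableSet_Ioi (h.mono_set Set.Ioc_subset_Ioi_self)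
      (h.mono_set (Set.Ioi_subset_Ioi hxy))]

lemma upperGamma_strictAnti {s x y : ℝ} (hs : 0 ≤ s) (hs1 : s ≤ 1) (hx : 0 < x) (hxy : x < y) :
    upperGamma s y < upperGamma s x := by
  rw [← sub_pos, upperGamma_sub hs hs1 hx hxy.le]
  refine intervalIntegral.intervalIntegral_pos_of_pos_on ?_ (fun t ht => ?_) hxy
  · rw [intervalIntegrable_iff_integrableOn_Ioc_of_le hxy.le]
    exact (integrableOn_upperGamma hs hs1 hx).mono_set Set.Ioc_subset_Ioi_self
  · have : 0 < t := hx.trans ht.1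
    positivity

lemma upperGamma_nonneg {s x : ℝ} (hx : 0 ≤ x) : 0 ≤ upperGamma s x :=
  setIntegral_nonneg measurableSet_Ioi fun t ht => by
    have : 0 < t := hx.trans_lt ht
    positivity

lemma tendsto_upperGamma {x : ℝ} (hx : 0 < x) {s : ℕ → ℝ} (hs : ∀ n, 0 ≤ s n)
    (hs0 : Tendsto s atTop (𝓝 0)) :
    Tendsto (fun n => upperGamma (s n) x) atTop (𝓝 (upperGamma 0 x)) := by
  refine tendsto_integral_filter_of_dominated_convergence (fun t => 2 * (t * (1 + t))⁻¹)
    (.of_forall fun n => (measurable_rpow_mul_exp_neg _).aestronglyMeasurable) ?_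
    ((integrableOn_inv_mul_one_add hx).const_mul 2) ?_
  · filter_upwards [hs0.eventually_le_const one_pos] with n hn
    filter_upwards [ae_restrict_mem measurableSet_Ioi] with t ht
    exact norm_rpow_sub_one_mul_exp_neg_le (hs n) hn (hx.trans ht)
  · filter_upwards [ae_restrict_mem measurableSet_Ioi] with t ht
    have ht : 0 < t := hx.trans ht
    refine Tendsto.mul_const _ ?_
    exact (tendsto_const_nhds (x := t)).rpow (hs0.sub_const 1) (.inl ht.ne')

/-- On `[x, 1]` the integrand is at least `e^{-1} / t`. The logarithmic blow-up at `0` is what makes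
`L⁻¹` strictly positive. -/
lemma log_inv_le_upperGamma_zero {x : ℝ} (hx : 0 < x) (hx1 : x ≤ 1) :
    Real.exp (-1) * Real.log x⁻¹ ≤ upperGamma 0 x := by
  have h1 := upperGamma_sub le_rfl zero_le_one hx hx1
  have h2 : (0 : ℝ) ≤ upperGamma 0 1 := upperGamma_nonneg zero_le_one
  have h3 : ∫ t in x..1, t⁻¹ * Real.exp (-1) ≤ ∫ t in x..1, t ^ ((0 : ℝ) - 1) * Real.exp (-t) := by
    refine intervalIntegral.integral_mono_on hx1 ?_ ?_ fun t ht => ?_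
    · refine ContinuousOn.intervalIntegrable_of_Icc hx1 ?_
      exact (continuousOn_id.inv₀ fun t ht => (hx.trans_le ht.1).ne').mul continuousOn_const
    · rw [intervalIntegrable_iff_integrableOn_Ioc_of_le hx1]
      exact (integrableOn_upperGamma le_rfl zero_le_one hx).mono_set Set.Ioc_subset_Ioi_self
    · have ht0 : 0 < t := hx.trans_le ht.1
      rw [zero_sub, Real.rpow_neg_one]
      have := ht.2
      gcongr
  rw [intervalIntegral.integral_mul_const, integral_inv_of_pos hx one_pos, one_div, mul_comm, ← h1] at h3
  linarith

/-! ### The Lévy tail, the gamma co-cdf and their inverses -/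

lemma levyTail_eq_upperGamma (a x : ℝ) :
    levyTail a x = a * upperGamma 0 x := by
  unfold levyTail upperGamma
  congr 1
  refine setIntegral_congr_fun measurableSet_Ioi fun t _ => ?_
  simp only [zero_sub, Real.rpow_neg_one]

lemma gammaCoCDF_eq_upperGamma {α x : ℝ} (hα : 0 < α) (hx : 0 ≤ x) :
    gammaCoCDF α x = (Real.Gamma α)⁻¹ * upperGamma α x := by
  rw [gammaCoCDF, gammaMeasure, measureReal_def, withDensity_apply _ measurableSet_Ioi, upperGamma,
    ← integral_const_mul]
  have : ∫ t in Set.Ioi x, (Real.Gamma α)⁻¹ * (t ^ (α - 1) * Real.exp (-t)) =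
      ∫ t in Set.Ioi x, gammaPDFReal α 1 t := by
    refine setIntegral_congr_fun measurableSet_Ioi fun t ht => ?_
    have ht0 : 0 ≤ t := hx.trans (le_of_lt ht)
    simp only [gammaPDFReal, if_pos ht0, Real.one_rpow, one_mul]
    ring
  rw [this, integral_eq_lintegral_of_nonneg_ae]
  · rfl
  · exact ae_of_all _ fun t => gammaPDFReal_nonneg hα one_pos t
  · fun_prop

lemma levyTail_strictAnti {a x y : ℝ} (ha : 0 < a) (hx : 0 < x) (hxy : x < y) :
    levyTail a y < levyTail a x := by
  rw [levyTail_eq_upperGamma, levyTail_eq_upperGamma]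
  exact mul_lt_mul_of_pos_left (upperGamma_strictAnti le_rfl zero_le_one hx hxy) ha

lemma log_one_add_inv_inv_exp_sub_one (q : ℝ) :
    Real.log (1 + ((Real.exp q - 1)⁻¹)⁻¹) = q := by
  rw [inv_inv, add_sub_cancel, Real.log_exp]

lemma inv_exp_sub_one_pos {q : ℝ} (hq : 0 < q) : 0 < (Real.exp q - 1)⁻¹ :=
  inv_pos.2 (sub_pos.2 (Real.one_lt_exp_iff.2 hq))

lemma levyTailInv_set_nonempty {a y : ℝ} (ha : 0 < a) (hy : 0 < y) :
    {x : ℝ | 0 < x ∧ levyTail a x ≤ y}.Nonempty := by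
  have hq : 0 < y / (2 * a) := by positivity
  refine ⟨(Real.exp (y / (2 * a)) - 1)⁻¹, inv_exp_sub_one_pos hq, ?_⟩
  rw [levyTail_eq_upperGamma]
  calc a * upperGamma 0 (Real.exp (y / (2 * a)) - 1)⁻¹ ≤ a * (2 * (y / (2 * a))) := by
        gcongr
        have := upperGamma_le le_rfl zero_le_one (inv_exp_sub_one_pos hq)
        rwa [log_one_add_inv_inv_exp_sub_one] at this
    _ = y := by field_simp

lemma bddBelow_levyTailInv_set (a y : ℝ) : BddBelow {x : ℝ | 0 < x ∧ levyTail a x ≤ y} :=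
  ⟨0, fun _ hx => hx.1.le⟩

lemma levyTailInv_pos {a y : ℝ} (ha : 0 < a) (hy : 0 < y) : 0 < levyTailInv a y := by
  -- Chosen so that the logarithmic lower bound at `e^{-q}` gives `L(e^{-q}) ≥ y + a / e > y`.
  have hq : 0 < y / (a * Real.exp (-1)) + 1 := by positivity
  set q := y / (a * Real.exp (-1)) + 1 with hqdef
  have hx : 0 < Real.exp (-q) := Real.exp_pos _
  have h1 : y < levyTail a (Real.exp (-q)) := by
    have h2 := log_inv_le_upperGamma_zero hx (Real.exp_le_one_iff.2 (by linarith))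
    rw [Real.log_inv, Real.log_exp, neg_neg] at h2
    rw [levyTail_eq_upperGamma]
    calc y < a * (Real.exp (-1) * q) := by
          have : a * (Real.exp (-1) * q) = y + a * Real.exp (-1) := by
            rw [hqdef]; field_simp
          have h3 : 0 < a * Real.exp (-1) := by positivity
          linarith
      _ ≤ _ := by gcongr
  refine hx.trans_le (le_csInf (levyTailInv_set_nonempty ha hy) fun x hxm => ?_)
  by_contra! hlt
  have := levyTail_strictAnti ha hxm.1 hlt
  linarith [hxm.2]

lemma lt_levyTail_of_lt_levyTailInv {a x y : ℝ} (hx : 0 < x) (h : x < levyTailInv a y) :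
    y < levyTail a x := by
  by_contra! hle
  exact h.not_ge (csInf_le (bddBelow_levyTailInv_set a y) ⟨hx, hle⟩)

lemma levyTail_lt_of_levyTailInv_lt {a x y : ℝ} (ha : 0 < a) (hy : 0 < y)
    (h : levyTailInv a y < x) : levyTail a x < y := by
  obtain ⟨z, hz, hzx⟩ := exists_lt_of_csInf_lt (levyTailInv_set_nonempty ha hy) h
  exact (levyTail_strictAnti ha hz.1 hzx).trans_le hz.2

lemma gammaCoCDF_antitone {α : ℝ} (hα : 0 < α) : Antitone (gammaCoCDF α) := fun x y hxy => by
  have := isProbabilityMeasure_gammaMeasure hα one_pos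
  exact measureReal_mono (Set.Ioi_subset_Ioi hxy)

lemma gammaCoCDF_zero {α : ℝ} (hα : 0 < α) : gammaCoCDF α 0 = 1 := by
  rw [gammaCoCDF_eq_upperGamma hα le_rfl, upperGamma]
  simp_rw [mul_comm (_ ^ (α - 1))]
  rw [← Real.Gamma_eq_integral hα, inv_mul_cancel₀ (Real.Gamma_pos_of_pos hα).ne']

lemma pos_of_gammaCoCDF_lt_one {α x : ℝ} (hα : 0 < α) (h : gammaCoCDF α x < 1) : 0 < x := by
  by_contra! hx
  exact h.not_ge (gammaCoCDF_zero hα ▸ gammaCoCDF_antitone hα hx)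

lemma gammaCoCDF_eq_one_sub_cdf {α : ℝ} (hα : 0 < α) (x : ℝ) :
    gammaCoCDF α x = 1 - cdf (gammaMeasure α 1) x := by
  have := isProbabilityMeasure_gammaMeasure hα one_pos
  rw [cdf_eq_real, gammaCoCDF, ← Set.compl_Iic, probReal_compl_eq_one_sub measurableSet_Iic]

lemma gammaCoCDFInv_set_nonempty {α p : ℝ} (hα : 0 < α) (hp : 0 < p) :
    {x : ℝ | gammaCoCDF α x ≤ p}.Nonempty := by
  obtain ⟨x, hx⟩ := ((tendsto_cdf_atTop (gammaMeasure α 1)).eventually_const_le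
    (sub_lt_self 1 hp)).exists
  refine ⟨x, ?_⟩
  rw [Set.mem_ofPred_eq, gammaCoCDF_eq_one_sub_cdf hα]
  linarith

/-- For `p ≥ 1` the set is all of `ℝ` and its `sInf` is a default value, hence `p < 1`. -/
lemma bddBelow_gammaCoCDFInv_set {α p : ℝ} (hα : 0 < α) (hp : p < 1) :
    BddBelow {x : ℝ | gammaCoCDF α x ≤ p} :=
  ⟨0, fun _ hx => (pos_of_gammaCoCDF_lt_one hα (lt_of_le_of_lt hx hp)).le⟩

lemma gammaCoCDFInv_pos {α p : ℝ} (hα : 0 < α) (hp : 0 < p) (hp1 : p < 1) :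
    0 < gammaCoCDFInv α p := by
  have h0 : cdf (gammaMeasure α 1) 0 = 0 := by
    have := gammaCoCDF_eq_one_sub_cdf hα 0
    rw [gammaCoCDF_zero hα] at this
    linarith
  have hc : Tendsto (cdf (gammaMeasure α 1)) (𝓝[>] 0) (𝓝 0) := by
    have := ((cdf (gammaMeasure α 1)).right_continuous 0).mono Set.Ioi_subset_Ici_self
    rwa [ContinuousWithinAt, h0] at this
  obtain ⟨x, hx, hx0⟩ := ((hc.eventually_lt_const (sub_pos.2 hp1)).and
    self_mem_nhdsWithin).exists
  refine (show 0 < x from hx0).trans_le (le_csInf (gammaCoCDFInv_set_nonempty hα hp) fun z hz => ?_)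
  by_contra! hlt
  have h1 := gammaCoCDF_antitone hα hlt.le
  rw [gammaCoCDF_eq_one_sub_cdf hα x] at h1
  have h2 : gammaCoCDF α z ≤ p := hz
  linarith

lemma gammaCoCDFInv_le {α p : ℝ} (hα : 0 < α) (hα1 : α ≤ 1) (hp : 0 < p) (hp1 : p < 1) :
    gammaCoCDFInv α p ≤ (Real.exp (p * Real.Gamma α / 2) - 1)⁻¹ := by
  have hΓ := Real.Gamma_pos_of_pos hα
  have hq : 0 < p * Real.Gamma α / 2 := by positivity
  refine csInf_le (bddBelow_gammaCoCDFInv_set hα hp1) ?_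
  rw [Set.mem_ofPred_eq, gammaCoCDF_eq_upperGamma hα (inv_exp_sub_one_pos hq).le]
  calc _ ≤ (Real.Gamma α)⁻¹ * (2 * (p * Real.Gamma α / 2)) := by
        gcongr
        have := upperGamma_le hα.le hα1 (inv_exp_sub_one_pos hq)
        rwa [log_one_add_inv_inv_exp_sub_one] at this
    _ = p := by field_simp

/-! ### Small-shape limit of the tails and quantiles -/

lemma mul_inv_Gamma_div_eq {a n : ℝ} (ha : 0 < a) (hn : 0 < n) :
    n * (Real.Gamma (a / n))⁻¹ = a / Real.Gamma (a / n + 1) := by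
  have h := Real.Gamma_pos_of_pos (div_pos ha hn)
  rw [Real.Gamma_add_one (div_pos ha hn).ne']
  field_simp

lemma tendsto_Gamma_div_add_one (a : ℝ) :
    Tendsto (fun N : ℕ => Real.Gamma (a / N + 1)) atTop (𝓝 1) := by
  have hc : ContinuousAt Real.Gamma 1 :=
    (Real.differentiableAt_Gamma fun m => by
      have : (0 : ℝ) ≤ m := m.cast_nonneg
      linarith).continuousAt
  have h : Tendsto (fun N : ℕ => a / N + 1) atTop (𝓝 1) := by
    simpa using (tendsto_const_div_atTop_nhds_zero_nat a).add_const 1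
  have := hc.tendsto.comp h
  rwa [Real.Gamma_one] at this

/-- The co-cdf of the gamma law with small shape, rescaled, converges to the Lévy tail. -/
lemma tendsto_mul_gammaCoCDF {a x : ℝ} (ha : 0 < a) (hx : 0 < x) :
    Tendsto (fun N : ℕ => N * gammaCoCDF (a / N) x) atTop (𝓝 (levyTail a x)) := by
  have h1 : Tendsto (fun N : ℕ => a / Real.Gamma (a / N + 1) * upperGamma (a / N) x) atTop
      (𝓝 (a / 1 * upperGamma 0 x)) :=
    (tendsto_const_nhds.div (tendsto_Gamma_div_add_one a) one_ne_zero).mul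
      (tendsto_upperGamma hx (fun n => by positivity) (tendsto_const_div_atTop_nhds_zero_nat a))
  rw [div_one, ← levyTail_eq_upperGamma] at h1
  refine h1.congr' ?_
  filter_upwards [eventually_gt_atTop 0] with N hN
  have hN : (0 : ℝ) < N := Nat.cast_pos.2 hN
  rw [gammaCoCDF_eq_upperGamma (div_pos ha hN) hx.le, ← mul_inv_Gamma_div_eq ha hN, mul_assoc]

lemma tendsto_gammaCoCDFInv {a y : ℝ} (ha : 0 < a) (hy : 0 < y) {p : ℕ → ℝ}
    (hp : Tendsto (fun N : ℕ => N * p N) atTop (𝓝 y)) :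
    Tendsto (fun N : ℕ => gammaCoCDFInv (a / N) (p N)) atTop (𝓝 (levyTailInv a y)) := by
  have hpos : ∀ᶠ N : ℕ in atTop, (0 : ℝ) < N := by
    filter_upwards [eventually_gt_atTop 0] with N hN using Nat.cast_pos.2 hN
  have hp1 : ∀ᶠ N in atTop, p N < 1 := by
    filter_upwards [hpos, hp.eventually_lt_const (lt_add_one y),
      tendsto_natCast_atTop_atTop.eventually_gt_atTop (y + 1)] with N hN h1 h2
    by_contra! h
    nlinarith
  have hmem : ∀ x, levyTailInv a y < x → ∀ᶠ N : ℕ in atTop, gammaCoCDF (a / N) x ≤ p N := by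
    intro x hx
    have hx0 : 0 < x := (levyTailInv_pos ha hy).trans hx
    filter_upwards [hpos, (tendsto_mul_gammaCoCDF ha hx0).eventually_lt hp
      (levyTail_lt_of_levyTailInv_lt ha hy hx)] with N hN h
    exact (lt_of_mul_lt_mul_left h hN.le).le
  refine tendsto_order.2 ⟨fun b hb => ?_, fun b hb => ?_⟩
  · obtain ⟨c, hc, hcx⟩ := exists_between (max_lt hb (levyTailInv_pos ha hy))
    have hc0 : 0 < c := (le_max_right _ _).trans_lt hc
    filter_upwards [hpos, hmem _ (lt_add_one _), hp.eventually_lt (tendsto_mul_gammaCoCDF ha hc0)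
      (lt_levyTail_of_lt_levyTailInv hc0 hcx)] with N hN hne h
    refine ((le_max_left _ _).trans_lt hc).trans_le (le_csInf ⟨_, hne⟩ fun z hz => ?_)
    by_contra! hlt
    have h1 := gammaCoCDF_antitone (div_pos ha hN) hlt.le
    exact (lt_of_mul_lt_mul_left h hN.le).not_ge (h1.trans hz)
  · obtain ⟨c, hxc, hcb⟩ := exists_between hb
    filter_upwards [hpos, hmem c hxc, hp1] with N hN h h1
    exact (csInf_le (bddBelow_gammaCoCDFInv_set (div_pos ha hN) h1) h).trans_lt hcb

/-! ### Dominated sums, discrete measures and the distance -/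

lemma summable_inv_exp_mul_sub_one {d : ℝ} (hd : 0 < d) :
    Summable fun i : ℕ => (Real.exp (d * (i + 1)) - 1)⁻¹ := by
  have h1 : 0 < Real.exp d - 1 := sub_pos.2 (Real.one_lt_exp_iff.2 hd)
  have hs : Summable fun i : ℕ => Real.exp (-d) ^ i * (Real.exp d - 1)⁻¹ :=
    (summable_geometric_of_lt_one (Real.exp_pos _).le
      (Real.exp_lt_one_iff.2 (neg_lt_zero.2 hd))).mul_right _
  refine hs.of_nonneg_of_le (fun i => (inv_exp_sub_one_pos (by positivity)).le) fun i => ?_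
  rw [← Real.exp_nat_mul, mul_neg, Real.exp_neg, ← mul_inv]
  refine inv_anti₀ (by positivity) ?_
  have h2 : Real.exp (d * (i + 1)) = Real.exp (i * d) * Real.exp d := by
    rw [← Real.exp_add]; ring_nf
  have h3 : 1 ≤ Real.exp (i * d) := Real.one_le_exp (by positivity)
  rw [h2]
  linarith

/-- Tannery's theorem for sums over initial segments. -/
lemma tendsto_sum_range_of_dominated {u : ℕ → ℕ → ℝ} {v b : ℕ → ℝ} (hb : Summable b)
    (hb0 : ∀ i, 0 ≤ b i) (hlim : ∀ i, Tendsto (fun N => u N i) atTop (𝓝 (v i)))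
    (hbd : ∀ᶠ N in atTop, ∀ i < N, |u N i| ≤ b i) :
    Tendsto (fun N => ∑ i ∈ Finset.range N, u N i) atTop (𝓝 (∑' i, v i)) := by
  have h : Tendsto (fun N => ∑' i, if i < N then u N i else 0) atTop (𝓝 (∑' i, v i)) := by
    refine tendsto_tsum_of_dominated_convergence hb (fun i => ?_) ?_
    · refine (hlim i).congr' ?_
      filter_upwards [eventually_gt_atTop i] with N hN
      rw [if_pos hN]
    · filter_upwards [hbd] with N hN i
      split_ifs with hi
      · exact hN i hi
      · simpa using hb0 i
  refine h.congr fun N => ?_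
  rw [tsum_eq_sum (s := Finset.range N) fun i hi => if_neg (by simpa using hi)]
  exact Finset.sum_congr rfl fun i hi => if_pos (Finset.mem_range.1 hi)

lemma measureReal_sum_smul_dirac {w : ℕ → ℝ} (hw : ∀ i, 0 ≤ w i) (hsum : Summable w) (y : ℕ → ℝ)
    {s : Set ℝ} (hs : MeasurableSet s) :
    (Measure.sum fun i => ENNReal.ofReal (w i) • Measure.dirac (y i)).real s =
      ∑' i, w i * s.indicator 1 (y i) := by
  have hle : ∀ i, w i * s.indicator 1 (y i) ≤ w i := fun i =>
    mul_le_of_le_one_right (hw i) (Set.indicator_le_self' (fun _ _ => zero_le_one) _)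
  have h0 : ∀ i, 0 ≤ w i * s.indicator 1 (y i) := fun i =>
    mul_nonneg (hw i) (Set.indicator_nonneg (fun _ _ => zero_le_one) _)
  rw [measureReal_def, Measure.sum_apply _ hs, ← ENNReal.toReal_ofReal (tsum_nonneg h0),
    ENNReal.ofReal_tsum_of_nonneg h0 (hsum.of_nonneg_of_le h0 hle)]
  congr 2 with i
  by_cases h : y i ∈ s <;> simp [hs, h]

lemma measureReal_finset_sum_smul_dirac {w : ℕ → ℝ} {t : Finset ℕ} (hw : ∀ i ∈ t, 0 ≤ w i)
    (y : ℕ → ℝ) {s : Set ℝ} (hs : MeasurableSet s) :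
    (∑ i ∈ t, ENNReal.ofReal (w i) • Measure.dirac (y i)).real s =
      ∑ i ∈ t, w i * s.indicator 1 (y i) := by
  rw [measureReal_def, Measure.finsetSum_apply, ENNReal.toReal_sum]
  · refine Finset.sum_congr rfl fun i hi => ?_
    by_cases h : y i ∈ s <;> simp [hs, h, hw i hi]
  · intro i _
    by_cases h : y i ∈ s <;> simp [hs, h]

lemma tendsto_dCvM {G P : Measure ℝ} [IsProbabilityMeasure G] {Q : ℕ → Measure ℝ}
    (h : ∀ x, Tendsto (fun N => cdf (Q N) x) atTop (𝓝 (cdf P x))) :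
    Tendsto (fun N => dCvM (Q N) G) atTop (𝓝 (dCvM P G)) := by
  refine tendsto_integral_of_dominated_convergence (fun _ => (1 : ℝ)) (fun N => ?_)
    (integrable_const 1) (fun N => ae_of_all _ fun x => ?_) (ae_of_all _ fun x => ?_)
  · exact (((monotone_cdf (Q N)).measurable.sub (monotone_cdf G).measurable).pow_const
      2).aestronglyMeasurable
  · rw [Real.norm_of_nonneg (sq_nonneg _), sq_le_one_iff_abs_le_one, abs_le]
    constructor <;> linarith [cdf_nonneg (Q N) x, cdf_nonneg G x, cdf_le_one (Q N) x,
      cdf_le_one G x]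
  · exact ((h x).sub_const _).pow 2

/-! ### Deterministic sequences with `S n / n → 1` -/

section Deterministic

variable {S : ℕ → ℝ}

lemma tendsto_natCast_div_succ (hlim : Tendsto (fun n : ℕ => S n / n) atTop (𝓝 1)) :
    Tendsto (fun N : ℕ => N / S (N + 1)) atTop (𝓝 1) := by
  have h1 : Tendsto (fun N : ℕ => (N : ℝ) / (N + 1) * (S (N + 1) / (N + 1 : ℕ))⁻¹) atTop
      (𝓝 (1 * 1⁻¹)) :=
    (tendsto_natCast_div_add_atTop (1 : ℝ)).mul
      (((tendsto_add_atTop_iff_nat 1).2 hlim).inv₀ one_ne_zero)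
  rw [inv_one, one_mul] at h1
  refine h1.congr fun N => ?_
  push_cast
  field_simp

lemma exists_mul_le_of_tendsto_div (hpos : ∀ n, 0 < S (n + 1))
    (hlim : Tendsto (fun n : ℕ => S n / n) atTop (𝓝 1)) :
    ∃ c > 0, ∀ i : ℕ, c * (i + 1) ≤ S (i + 1) := by
  have h := (((tendsto_add_atTop_iff_nat 1).2 hlim).inv₀ one_ne_zero).bddAbove_range
  obtain ⟨M, hM⟩ := h
  have hM' : ∀ i : ℕ, (i + 1) / S (i + 1) ≤ M := fun i => by
    simpa using hM (Set.mem_range_self i)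
  have hM0 : 0 < M := lt_of_lt_of_le (by have := hpos 0; positivity) (hM' 0)
  refine ⟨M⁻¹, by positivity, fun i => ?_⟩
  rw [inv_mul_le_iff₀ hM0]
  exact (div_le_iff₀ (hpos i)).1 (hM' i)

lemma tendsto_gammaCoCDFInv_ratio {a : ℝ} (ha : 0 < a) (hpos : ∀ n, 0 < S (n + 1))
    (hlim : Tendsto (fun n : ℕ => S n / n) atTop (𝓝 1)) (i : ℕ) :
    Tendsto (fun N : ℕ => gammaCoCDFInv (a / N) (S (i + 1) / S (N + 1))) atTop
      (𝓝 (levyTailInv a (S (i + 1)))) := by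
  refine tendsto_gammaCoCDFInv ha (hpos i) ?_
  have := (tendsto_natCast_div_succ hlim).mul_const (S (i + 1))
  rw [one_mul] at this
  exact this.congr fun N => by ring

lemma ratio_mem_Ioo (hS : StrictMono S) (hpos : ∀ n, 0 < S (n + 1)) {i N : ℕ} (hi : i < N) :
    S (i + 1) / S (N + 1) ∈ Set.Ioo (0 : ℝ) 1 :=
  ⟨div_pos (hpos i) (hpos N), (div_lt_one (hpos N)).2 (hS (by omega))⟩

lemma exists_eventually_gammaCoCDFInv_ratio_le {a : ℝ} (ha : 0 < a) (hS : StrictMono S)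
    (hpos : ∀ n, 0 < S (n + 1)) (hlim : Tendsto (fun n : ℕ => S n / n) atTop (𝓝 1)) :
    ∃ d > 0, ∀ᶠ N : ℕ in atTop, ∀ i < N,
      gammaCoCDFInv (a / N) (S (i + 1) / S (N + 1)) ≤ (Real.exp (d * (i + 1)) - 1)⁻¹ := by
  obtain ⟨c, hc, hcS⟩ := exists_mul_le_of_tendsto_div hpos hlim
  -- The 8 collects a factor 2 from the tail bound and one from each of `N / S (N + 1) ≥ 1/2`,
  -- `Γ(a/N + 1) ≥ 1/2`; the `a` comes from `Γ(a/N) = (N/a) Γ(a/N + 1)`.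
  refine ⟨c / (8 * a), by positivity, ?_⟩
  filter_upwards [eventually_gt_atTop 0,
    (tendsto_const_div_atTop_nhds_zero_nat a).eventually_le_const one_pos,
    (tendsto_natCast_div_succ hlim).eventually_const_le (show (1 / 2 : ℝ) < 1 by norm_num),
    (tendsto_Gamma_div_add_one a).eventually_const_le (show (1 / 2 : ℝ) < 1 by norm_num)]
    with N hN h1 h2 h3 i hi
  have hN : (0 : ℝ) < N := Nat.cast_pos.2 hN
  obtain ⟨hp, hp1⟩ := ratio_mem_Ioo hS hpos hi
  refine (gammaCoCDFInv_le (div_pos ha hN) h1 hp hp1).trans ?_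
  have hq : c / (8 * a) * (i + 1) ≤ S (i + 1) / S (N + 1) * Real.Gamma (a / N) / 2 := by
    have hΓ : Real.Gamma (a / N) = N / a * Real.Gamma (a / N + 1) := by
      rw [Real.Gamma_add_one (div_pos ha hN).ne']
      field_simp
    calc c / (8 * a) * (i + 1) = (c * (i + 1)) * (1 / 2) * (1 / 2) / (2 * a) := by
          field_simp; norm_num
      _ ≤ S (i + 1) * (N / S (N + 1)) * Real.Gamma (a / N + 1) / (2 * a) := by
          have := hpos i
          gcongr
          exact hcS i
      _ = _ := by rw [hΓ]; ring
  refine inv_anti₀ (inv_pos.1 (inv_exp_sub_one_pos (by positivity))) ?_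
  gcongr

end Deterministic

/-! ### Exponential variables and the strong law -/

lemma integral_id_expMeasure_one : ∫ x, x ∂(expMeasure 1) = 1 := by
  rw [expMeasure, gammaMeasure, integral_withDensity_eq_integral_toReal_smul
    (show Measurable (gammaPDF 1 1) from (measurable_gammaPDFReal 1 1).ennreal_ofReal) (ae_of_all _ fun x => ENNReal.ofReal_lt_top)]
  have h : ∀ x, (gammaPDF 1 1 x).toReal = gammaPDFReal 1 1 x := fun x =>
    ENNReal.toReal_ofReal (gammaPDFReal_nonneg one_pos one_pos x)
  simp_rw [h, smul_eq_mul]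
  rw [← setIntegral_eq_integral_of_forall_compl_eq_zero (s := Set.Ioi 0)]
  · have h2 := Real.Gamma_eq_integral (s := 2) two_pos
    rw [Real.Gamma_two] at h2
    refine Eq.trans ?_ h2.symm
    refine setIntegral_congr_fun measurableSet_Ioi fun x hx => ?_
    have hx : (0 : ℝ) < x := hx
    have h3 : (2 : ℝ) - 1 = 1 := by norm_num
    simp [gammaPDFReal, hx.le, h3]
  · intro x hx
    rcases (not_lt.1 (show ¬ (0 : ℝ) < x from hx)).lt_or_eq with h | h
    · simp [gammaPDFReal, h.not_ge]
    · simp [h]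

lemma ae_pos_expMeasure_one : ∀ᵐ x ∂(expMeasure 1), 0 < x := by
  have := isProbabilityMeasure_expMeasure (r := 1) one_pos
  rw [ae_iff]
  have h : expMeasure 1 (Set.Iic 0) = 0 := by
    rw [← ofReal_cdf, cdf_expMeasure_eq one_pos]
    simp
  simpa [Set.Iic] using h

lemma ae_tendsto_arrival_div {Ω : Type*} [MeasurableSpace Ω] {μ : Measure Ω}
    {E : ℕ → Ω → ℝ} (hE : ∀ k, HasLaw (E k) (expMeasure 1) μ) (hEind : iIndepFun E μ) :
    ∀ᵐ ω ∂μ, Tendsto (fun n : ℕ => arrival E n ω / n) atTop (𝓝 1) := by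
  have hint : ∫ ω, E 0 ω ∂μ = 1 := by rw [(hE 0).integral_eq, integral_id_expMeasure_one]
  -- Integrability is free: a non-integrable function has integral `0` by convention, not `1`.
  have h := strong_law_ae_real E (by
      by_contra hni
      rw [integral_undef hni] at hint
      exact zero_ne_one hint)
    (fun i j hij => hEind.indepFun hij) (fun i => (hE i).identDistrib (hE 0))
  rw [hint] at h
  exact h

/-! ### Pathwise convergence and conclusion -/

/-- Along arrival times growing like `n`, the two series define probability measures and the
distances converge. -/
lemma tendsto_dCvM_approxProcess {Ω : Type*} {a : ℝ} (ha : 0 < a) (G : Measure ℝ)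
    [IsProbabilityMeasure G] {E : ℕ → Ω → ℝ} (Y : ℕ → Ω → ℝ) {ω : Ω} (hE : ∀ k, 0 < E k ω)
    (hlim : Tendsto (fun n : ℕ => arrival E n ω / n) atTop (𝓝 1)) :
    IsProbabilityMeasure (fergusonSeries a E Y ω) ∧
      (∀ N : ℕ, 1 ≤ N → IsProbabilityMeasure (approxProcess a E Y N ω)) ∧
      Tendsto (fun N : ℕ => dCvM (approxProcess a E Y N ω) G) atTop
        (𝓝 (dCvM (fergusonSeries a E Y ω) G)) := by
  set S : ℕ → ℝ := fun n => arrival E n ω with hSdef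
  have hS : StrictMono S := strictMono_nat_of_lt_succ fun n => by
    simpa [hSdef, arrival, Finset.sum_range_succ] using hE n
  have hpos : ∀ n, 0 < S (n + 1) := fun n => by
    have := hS n.succ_pos
    simpa [hSdef, arrival] using this
  set u : ℕ → ℕ → ℝ := fun N i => gammaCoCDFInv (a / N) (S (i + 1) / S (N + 1)) with hu
  set v : ℕ → ℝ := fun i => levyTailInv a (S (i + 1)) with hv
  have hupos : ∀ N i, i < N → 0 < u N i := fun N i hi => by
    obtain ⟨hp, hp1⟩ := ratio_mem_Ioo hS hpos hi
    exact gammaCoCDFInv_pos (div_pos ha (Nat.cast_pos.2 (by omega))) hp hp1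
  have hvpos : ∀ i, 0 < v i := fun i => levyTailInv_pos ha (hpos i)
  have huv : ∀ i, Tendsto (fun N => u N i) atTop (𝓝 (v i)) :=
    tendsto_gammaCoCDFInv_ratio ha hpos hlim
  obtain ⟨d, hd, hub⟩ := exists_eventually_gammaCoCDFInv_ratio_le ha hS hpos hlim
  set b : ℕ → ℝ := fun i => (Real.exp (d * (i + 1)) - 1)⁻¹ with hbdef
  have hb : Summable b := summable_inv_exp_mul_sub_one hd
  have hb0 : ∀ i, 0 ≤ b i := fun i => (inv_exp_sub_one_pos (by positivity)).le
  -- The limit weights inherit the majorant, so Ferguson's series is summable with no separate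
  -- estimate.
  have hvb : ∀ i, v i ≤ b i := fun i => by
    refine le_of_tendsto (huv i) ?_
    filter_upwards [hub, eventually_gt_atTop i] with N hN hi using hN i hi
  have hvs : Summable v := hb.of_nonneg_of_le (fun i => (hvpos i).le) hvb
  have hV : 0 < ∑' i, v i := hvs.tsum_pos (fun i => (hvpos i).le) 0 (hvpos 0)
  have hU : ∀ N, 1 ≤ N → 0 < ∑ i ∈ Finset.range N, u N i := fun N hN =>
    Finset.sum_pos (fun i hi => hupos N i (Finset.mem_range.1 hi)) ⟨0, Finset.mem_range.2 hN⟩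
  have hPs : ∀ s, MeasurableSet s → (fergusonSeries a E Y ω).real s =
      (∑' i, v i * s.indicator 1 (Y i ω)) / ∑' i, v i := fun s hs => by
    rw [fergusonSeries, measureReal_sum_smul_dirac (w := fun i => v i / ∑' j, v j)
      (fun i => (div_pos (hvpos i) hV).le) (hvs.div_const _) (fun i => Y i ω) hs, ← tsum_div_const]
    exact tsum_congr fun i => by ring
  have hQs : ∀ N, 1 ≤ N → ∀ s, MeasurableSet s → (approxProcess a E Y N ω).real s =
      (∑ i ∈ Finset.range N, u N i * s.indicator 1 (Y i ω)) / ∑ i ∈ Finset.range N, u N i :=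
    fun N hN s hs => by
    rw [approxProcess, measureReal_finset_sum_smul_dirac
      (w := fun i => approxWeight a E N i ω)
      (fun i hi => (div_pos (hupos N i (Finset.mem_range.1 hi)) (hU N hN)).le)
      (fun i => Y i ω) hs, Finset.sum_div]
    exact Finset.sum_congr rfl fun i _ => div_mul_eq_mul_div _ _ _
  have hP1 : IsProbabilityMeasure (fergusonSeries a E Y ω) := by
    have h := hPs Set.univ .univ
    simp only [Set.indicator_univ, Pi.one_apply, mul_one, div_self hV.ne'] at h
    exact ⟨(ENNReal.toReal_eq_one_iff _).1 h⟩
  have hQ1 : ∀ N : ℕ, 1 ≤ N → IsProbabilityMeasure (approxProcess a E Y N ω) := fun N hN => by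
    have h := hQs N hN Set.univ .univ
    simp only [Set.indicator_univ, Pi.one_apply, mul_one, div_self (hU N hN).ne'] at h
    exact ⟨(ENNReal.toReal_eq_one_iff _).1 h⟩
  refine ⟨hP1, hQ1, tendsto_dCvM fun x => ?_⟩
  have habs : ∀ᶠ N in atTop, ∀ i < N, |u N i| ≤ b i := by
    filter_upwards [hub] with N hN i hi
    rw [abs_of_pos (hupos N i hi)]
    exact hN i hi
  have hnum : Tendsto (fun N => ∑ i ∈ Finset.range N, u N i * (Set.Iic x).indicator 1 (Y i ω))
      atTop (𝓝 (∑' i, v i * (Set.Iic x).indicator 1 (Y i ω))) := by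
    refine tendsto_sum_range_of_dominated hb hb0 (fun i => (huv i).mul_const _) ?_
    filter_upwards [habs] with N hN i hi
    by_cases h : Y i ω ∈ Set.Iic x
    · simpa [Set.indicator_of_mem h] using hN i hi
    · simpa [Set.indicator_of_notMem h] using hb0 i
  rw [cdf_eq_real, hPs _ measurableSet_Iic]
  refine (hnum.div (tendsto_sum_range_of_dominated hb hb0 huv habs) hV.ne').congr' ?_
  filter_upwards [eventually_ge_atTop 1] with N hN
  have := hQ1 N hN
  rw [cdf_eq_real, hQs N hN _ measurableSet_Iic]
  rfl

theorem lemma2 {Ω : Type*} [MeasurableSpace Ω] (μ : Measure Ω) [IsProbabilityMeasure μ]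
    (a : ℝ) (ha : 0 < a)
    (H G : Measure ℝ) [IsProbabilityMeasure H] [IsProbabilityMeasure G]
    (E Y : ℕ → Ω → ℝ)
    (hE : ∀ k, HasLaw (E k) (expMeasure 1) μ) (hEind : iIndepFun E μ)
    (hY : ∀ i, HasLaw (Y i) H μ) (hYind : iIndepFun Y μ)
    (hYE : IndepFun (fun ω i => Y i ω) (fun ω k => arrival E (k + 1) ω) μ) :
    ∀ᵐ ω ∂μ,
      IsProbabilityMeasure (fergusonSeries a E Y ω) ∧
      (∀ N : ℕ, 1 ≤ N → IsProbabilityMeasure (approxProcess a E Y N ω)) ∧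
      Tendsto (fun N : ℕ => dCvM (approxProcess a E Y N ω) G) atTop
        (𝓝 (dCvM (fergusonSeries a E Y ω) G)) := by
  have hEpos : ∀ᵐ ω ∂μ, ∀ k, 0 < E k ω := ae_all_iff.2 fun k =>
    ((hE k).ae_iff (measurable_const.lt measurable_id)).2 ae_pos_expMeasure_one
  filter_upwards [hEpos, ae_tendsto_arrival_div hE hEind] with ω hω hlim
  exact tendsto_dCvM_approxProcess ha G Y hω hlim
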